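/- Let $(f_t)_{t\in\mathbb R}$, $f_t(y)=\exp\{(yt-b(t))/a+c(y,a)\}$, be a natural exponential family of probability densities on $\mathbb R$ (with respect to some $\sigma$-finite measure), with scaling parameter $a>0$ and twice differentiable $b:\mathbb R\to\mathbb R$. Let $Y_1,\dots,Y_n$ be independent, $Y_i\sim f_{\theta_i}$, with $\theta_i\in\Theta$ for all $i$. Assumption (A): $\Theta\subseteq\mathbb R$ is a closed (finite or infinite) interval, and there are constants $0<\mathcal L\le\mathcal U<\infty$ with $\sup_{t\in\mathbb R}b''(t)\le\mathcal U$ and $\inf_{t\in\Theta}b''(t)\ge\mathcal L$. Let $X$ be a deterministic $n\times p$ matrix of rank $r$, any $r$ columns of which are linearly independent. It is not assumed that $\theta=X\beta$ for some $\beta$ (the link may be misspecified). Let $\mathfrak M$ be the set of all $M\subseteq\{1,\dots,p\}$ with $|M|\le r$, and for $M\in\mathfrak M$ put $$\mathcal B_M=\{\beta\in\mathbb R^p:\ \beta_j=0\text{ for }j\notin M,\ (X\beta)_i\in\Theta\text{ for }i=1,\dots,n\}.$$ Let $\ell(\beta)=\frac1a\sum_{i=1}^n\{Y_i(X\beta)_i-b((X\beta)_i)\}$,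 and for every $M\in\mathfrak M$ with $\mathcal B_M\neq\emptyset$ let $\widehat\beta_M$ be a maximizer of $\ell$ over $\mathcal B_M$ (a maximum likelihood estimator). For a penalty $Pen$ let $\widehat M$ be a minimizer of $-\ell(\widehat\beta_M)+Pen(|M|)$ over all $M\in\mathfrak M$ with $\mathcal B_M\neq\emptyset$. Let $KL(\theta,\zeta)$ be the Kullback-Leibler divergence between the joint laws of $n$ independent observations with natural parameters $\theta$ and $\zeta$. Let $L_1,\dots,L_r>0$ and $S$ be such that $$\sum_{k=1}^{r-1}\binom pk e^{-kL_k}+e^{-rL_r}\le S,$$ and suppose that $Pen(0)\ge0$ and, for some $A>1$, $$Pen(k)\ \ge\ 2\,\frac{\mathcal U}{\mathcal L}\,k\left(A+2\sqrt{2L_k}+4L_k\right),\qquad k=1,\dots,r.$$ Then $$\mathbb E\,KL(\theta,X\widehat\beta_{\widehat M})\ \le\ \frac43\inf_{M\in\mathfrak M}\Big\{\inf_{\beta\in\mathcal B_M}KL(\theta,X\beta)+Pen(|M|)\Big\}+\frac{16}3\,\frac{\mathcal U}{\mathcal L}\,\frac{2A-1}{A-1}\,S,$$ where the infimum over an empty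 set is $+\infty$. -/

import Mathlib

open MeasureTheory ProbabilityTheory
open scoped ENNReal

/-- The density `f_t(y) = exp((y t - b(t)) / a + c(y))` of a natural exponential family with
natural parameter `t` and (fixed) scaling parameter `a`; `c` stands for `c(·, a)`. -/
noncomputable def expFamilyDensity (a : ℝ) (b c : ℝ → ℝ) (t y : ℝ) : ℝ :=
  Real.exp ((y * t - b t) / a + c y)

/-- The measure on `ℝ` with density `f_t` with respect to the dominating measure `ν`. -/
noncomputable def expFamilyLaw (ν : Measure ℝ) (a : ℝ) (b c : ℝ → ℝ) (t : ℝ) : Measure ℝ :=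
  ν.withDensity fun y => ENNReal.ofReal (expFamilyDensity a b c t y)

/-- `(ν, a, b, c)` defines a natural exponential family whose natural parameter ranges over the
whole real line, with scaling parameter `a > 0` and twice differentiable `b`. -/
structure IsNaturalExpFamily (ν : Measure ℝ) (a : ℝ) (b c : ℝ → ℝ) : Prop where
  scale_pos : 0 < a
  measurable_c : Measurable c
  differentiable_b : Differentiable ℝ b
  differentiable_deriv_b : Differentiable ℝ (deriv b)
  isProbabilityMeasure : ∀ t : ℝ, IsProbabilityMeasure (expFamilyLaw ν a b c t)

/-- The parameter space `Θ` is a closed (finite or infinite) interval, `b'' ≤ Up` on the whole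
line and `b'' ≥ Lo` on `Θ`, where `0 < Lo ≤ Up`. -/
structure CurvatureAssumption (b : ℝ → ℝ) (Θ : Set ℝ) (Lo Up : ℝ) : Prop where
  isClosed : IsClosed Θ
  ordConnected : Θ.OrdConnected
  lo_pos : 0 < Lo
  lo_le_up : Lo ≤ Up
  deriv2_le : ∀ t : ℝ, deriv (deriv b) t ≤ Up
  le_deriv2 : ∀ t ∈ Θ, Lo ≤ deriv (deriv b) t

/-- Joint law of independent observations with natural parameters `ζ 0, …, ζ (n - 1)`. -/
noncomputable def glmLaw {n : ℕ} (ν : Measure ℝ) (a : ℝ) (b c : ℝ → ℝ) (ζ : Fin n → ℝ) :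
    Measure (Fin n → ℝ) :=
  Measure.pi fun i => expFamilyLaw ν a b c (ζ i)

/-- The Kullback-Leibler divergence `KL(θ, ζ)` between the joint laws with natural parameters
`θ` and `ζ`. -/
noncomputable def glmKL {n : ℕ} (ν : Measure ℝ) (a : ℝ) (b c : ℝ → ℝ) (θ ζ : Fin n → ℝ) : ℝ≥0∞ :=
  InformationTheory.klDiv (glmLaw ν a b c θ) (glmLaw ν a b c ζ)

/-- The log-likelihood of the natural parameter vector `ζ` at the data `y`, up to the additive
term `∑ i, c (y i)`, which does not depend on `ζ`. -/
noncomputable def logLik {n : ℕ} (a : ℝ) (b : ℝ → ℝ) (y ζ : Fin n → ℝ) : ℝ :=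
  (1 / a) * ∑ i, (y i * ζ i - b (ζ i))

/-- The coefficient set `B_M`: vectors supported in `M` all of whose linear predictors lie
in `Θ`. -/
def coeffSet {n p : ℕ} (X : Matrix (Fin n) (Fin p) ℝ) (Θ : Set ℝ) (M : Finset (Fin p)) :
    Set (Fin p → ℝ) :=
  {β | (∀ j, j ∉ M → β j = 0) ∧ ∀ i, X.mulVec β i ∈ Θ}

/-- The models under consideration: all sets of at most `rank X` predictors. -/
def models {n p : ℕ} (X : Matrix (Fin n) (Fin p) ℝ) : Set (Finset (Fin p)) :=
  {M | M.card ≤ X.rank}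

/-- `β` is a maximum likelihood estimate in the model `M` at the data `y`. -/
def IsMLE {n p : ℕ} (a : ℝ) (b : ℝ → ℝ) (X : Matrix (Fin n) (Fin p) ℝ) (Θ : Set ℝ)
    (M : Finset (Fin p)) (y : Fin n → ℝ) (β : Fin p → ℝ) : Prop :=
  β ∈ coeffSet X Θ M ∧
    IsMaxOn (fun β' => logLik a b y (X.mulVec β')) (coeffSet X Θ M) β

/-- The model `M` minimizes `-ℓ(β̂_M) + Pen(|M|)` at the data `y`, among the models of size at
most `rank X` with a nonempty coefficient set, where `βhat M` is the estimate in the model `M`. -/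
def IsPenalizedSelection {n p : ℕ} (a : ℝ) (b : ℝ → ℝ) (X : Matrix (Fin n) (Fin p) ℝ)
    (Θ : Set ℝ) (Pen : ℕ → ℝ) (y : Fin n → ℝ) (βhat : Finset (Fin p) → Fin p → ℝ)
    (M : Finset (Fin p)) : Prop :=
  (M ∈ models X ∧ (coeffSet X Θ M).Nonempty) ∧
    ∀ M' ∈ models X, (coeffSet X Θ M').Nonempty →
      -logLik a b y (X.mulVec (βhat M)) + Pen M.card
        ≤ -logLik a b y (X.mulVec (βhat M')) + Pen M'.card

/-!
The divergence between joint laws of the model is a Bregman divergence `K` of the cumulant function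
`b` (`glmKL_eq_ofReal_bregmanKL`), and the log-likelihood of `ζ` is `-K(θ, ζ)` plus the noise
`⟨ζ - θ, Y - b'(θ)⟩ / a`, up to a term free of `ζ` (`logLik_sub_logLik`). Comparing the selected
estimate `ζ̂ = X β̂` with a fixed competitor `ζ = X β`, `β ∈ B_M`, therefore gives

`K(θ, ζ̂) + Pen(|M̂|) ≤ K(θ, ζ) + Pen(|M|) - noise(ζ) + noise(ζ̂)`.

The noise of the deterministic competitor has mean zero. The noise of `ζ̂` has to be absorbed by
`K(θ, ζ̂) / 4`, which produces the factor `4 / 3`, and by the penalty. Since `K` dominates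
`Lo / (2 a) * ‖ζ̂ - θ‖²` on `Θ`, the remainder is `2 / (a Lo)` times the squared projection of
`Y - b'(θ)` onto the span of `θ` and the columns of the selected model, a space of dimension at most
`|M̂| + 1`. As `b'' ≤ Up`, the noise is sub-Gaussian with variance proxy `a Up`, and its squared
projections have chi-square exponential moments (`lintegral_exp_sum_sq_le`).

The additional dimension, caused by `θ` not being in the model, is delicate for the empty model: it
has no penalty, and `S` may be arbitrarily small, so the excess there cannot be paid for by `S`.
Instead the nonempty models are made to pay. Their penalties absorb the noise with `4 Up / Lo` to
spare (`exists_noise_excess`, where the tilt of the Chernoff bound is chosen in `exists_tilt`), and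
for the empty model, where only the one-dimensional noise in the direction `θ` matters, the excess
over `-4 Up / Lo` is bounded by a variable with expectation at most `4 Up / Lo`
(`exists_noise_excess_empty`). The two amounts cancel in expectation. Summing the excesses of all
models, those of maximal size counted once because they share the column space of `X`, leaves
`4 (Up / Lo) ((2 A - 1) / (A - 1)) S` (`exists_uniform_noise_excess`).

The estimate and the selected model need not be measurable: they enter only through a pointwise
bound by an integrable function of the observations.
-/

/-! ### Densities and divergences of product measures -/

lemma lintegral_pi_prod {n : ℕ} {μ : Fin n → Measure ℝ} [∀ i, IsProbabilityMeasure (μ i)]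
    {f : Fin n → ℝ → ℝ≥0∞} (hf : ∀ i, Measurable (f i)) :
    ∫⁻ x, ∏ i, f i (x i) ∂(Measure.pi μ) = ∏ i, ∫⁻ y, f i y ∂(μ i) := by
  have hind : iIndepFun (fun i (x : Fin n → ℝ) ↦ f i (x i)) (Measure.pi μ) :=
    iIndepFun_pi (X := f) fun i ↦ (hf i).aemeasurable
  rw [lintegral_prod_eq_prod_lintegral_of_indepFun (s := Finset.univ)
    (X := fun i (x : Fin n → ℝ) ↦ f i (x i)) hind
    fun i ↦ (hf i).comp (measurable_pi_apply i)]
  refine Finset.prod_congr rfl fun i _ ↦ ?_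
  exact (measurePreserving_eval μ i).lintegral_comp (hf i)

lemma pi_withDensity {n : ℕ} {μ : Fin n → Measure ℝ} [∀ i, IsProbabilityMeasure (μ i)]
    {f : Fin n → ℝ → ℝ≥0∞} (hf : ∀ i, Measurable (f i))
    [∀ i, SigmaFinite ((μ i).withDensity (f i))] :
    Measure.pi (fun i ↦ (μ i).withDensity (f i))
      = (Measure.pi μ).withDensity fun x ↦ ∏ i, f i (x i) := by
  refine Measure.pi_eq fun s hs ↦ ?_
  rw [withDensity_apply _ (MeasurableSet.univ_pi hs),
    ← lintegral_indicator (MeasurableSet.univ_pi hs)]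
  have h : (Set.univ.pi s).indicator (fun x : Fin n → ℝ ↦ ∏ i, f i (x i))
      = fun x ↦ ∏ i, (s i).indicator (f i) (x i) := by
    funext x
    by_cases hx : x ∈ Set.univ.pi s
    · rw [Set.indicator_of_mem hx]
      exact Finset.prod_congr rfl fun i _ ↦
        (Set.indicator_of_mem (hx i (Set.mem_univ i)) _).symm
    · rw [Set.indicator_of_notMem hx]
      obtain ⟨i, hi⟩ : ∃ i, x i ∉ s i := by simpa [Set.mem_pi] using hx
      exact (Finset.prod_eq_zero (Finset.mem_univ i) (Set.indicator_of_notMem hi _)).symm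
  rw [h, lintegral_pi_prod fun i ↦ (hf i).indicator (hs i)]
  refine Finset.prod_congr rfl fun i _ ↦ ?_
  rw [lintegral_indicator (hs i), withDensity_apply _ (hs i)]

lemma klDiv_withDensity_exp {α : Type*} {_ : MeasurableSpace α} (ν : Measure α)
    [IsProbabilityMeasure ν] {g : α → ℝ} (hg : Measurable g)
    [IsProbabilityMeasure (ν.withDensity fun x ↦ ENNReal.ofReal (Real.exp (g x)))]
    (hint : Integrable g (ν.withDensity fun x ↦ ENNReal.ofReal (Real.exp (g x)))) :
    InformationTheory.klDiv (ν.withDensity fun x ↦ ENNReal.ofReal (Real.exp (g x))) ν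
      = ENNReal.ofReal
          (∫ x, g x ∂(ν.withDensity fun x ↦ ENNReal.ofReal (Real.exp (g x)))) := by
  set μ := ν.withDensity fun x ↦ ENNReal.ofReal (Real.exp (g x)) with hμ
  have hac : μ ≪ ν := withDensity_absolutelyContinuous _ _
  have hllr : llr μ ν =ᵐ[μ] g := by
    have h := Measure.rnDeriv_withDensity ν
      (f := fun x ↦ ENNReal.ofReal (Real.exp (g x))) (by fun_prop)
    filter_upwards [hac.ae_le h] with x hx
    rw [llr_def]
    simp only
    rw [hμ, hx, ENNReal.toReal_ofReal (Real.exp_pos _).le, Real.log_exp]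
  rw [InformationTheory.klDiv_of_ac_of_integrable hac ((integrable_congr hllr).2 hint),
    integral_congr_ae hllr]
  simp

/-! ### Moments of a natural exponential family -/

namespace IsNaturalExpFamily

variable {ν : Measure ℝ} {a : ℝ} {b c : ℝ → ℝ}

lemma measurable_density (h : IsNaturalExpFamily ν a b c) (t : ℝ) :
    Measurable fun y ↦ ENNReal.ofReal (expFamilyDensity a b c t y) := by
  have := h.measurable_c
  unfold expFamilyDensity
  fun_prop

/-- Two members of the family differ by an exponential tilt. -/
lemma law_eq_withDensity (h : IsNaturalExpFamily ν a b c) (t u : ℝ) :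
    expFamilyLaw ν a b c t = (expFamilyLaw ν a b c u).withDensity
      fun y ↦ ENNReal.ofReal (Real.exp ((y * (t - u) - (b t - b u)) / a)) := by
  unfold expFamilyLaw
  rw [← withDensity_mul _ (h.measurable_density u) (by fun_prop)]
  congr 1
  funext y
  unfold expFamilyDensity
  rw [Pi.mul_apply, ← ENNReal.ofReal_mul (Real.exp_pos _).le, ← Real.exp_add]
  congr 2
  ring

lemma lintegral_exp_mul (h : IsNaturalExpFamily ν a b c) (t s : ℝ) :
    ∫⁻ y, ENNReal.ofReal (Real.exp (s * y)) ∂(expFamilyLaw ν a b c t)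
      = ENNReal.ofReal (Real.exp ((b (t + a * s) - b t) / a)) := by
  have ha := h.scale_pos.ne'
  have h1 := (h.isProbabilityMeasure (t + a * s)).measure_univ
  rw [h.law_eq_withDensity (t + a * s) t, withDensity_apply _ MeasurableSet.univ,
    Measure.restrict_univ] at h1
  have h2 : ∀ y, ENNReal.ofReal (Real.exp (s * y))
      = ENNReal.ofReal (Real.exp ((b (t + a * s) - b t) / a)) *
        ENNReal.ofReal (Real.exp ((y * (t + a * s - t) - (b (t + a * s) - b t)) / a)) := by
    intro y
    rw [← ENNReal.ofReal_mul (Real.exp_pos _).le, ← Real.exp_add]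
    congr 2
    field_simp
    ring
  simp_rw [h2]
  rw [lintegral_const_mul _ (by fun_prop), h1, mul_one]

lemma integrable_exp_mul (h : IsNaturalExpFamily ν a b c) (t s : ℝ) :
    Integrable (fun y ↦ Real.exp (s * y)) (expFamilyLaw ν a b c t) := by
  refine (lintegral_ofReal_ne_top_iff_integrable (by fun_prop)
    (ae_of_all _ fun _ ↦ (Real.exp_pos _).le)).1 ?_
  rw [h.lintegral_exp_mul]
  exact ENNReal.ofReal_ne_top

lemma mgf_eq (h : IsNaturalExpFamily ν a b c) (t s : ℝ) :
    mgf id (expFamilyLaw ν a b c t) s = Real.exp ((b (t + a * s) - b t) / a) := by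
  unfold mgf
  rw [integral_eq_lintegral_of_nonneg_ae (ae_of_all _ fun _ ↦ (Real.exp_pos _).le) (by fun_prop)]
  simp only [id]
  rw [h.lintegral_exp_mul, ENNReal.toReal_ofReal (Real.exp_pos _).le]

lemma zero_mem_interior_integrableExpSet (h : IsNaturalExpFamily ν a b c) (t : ℝ) :
    0 ∈ interior (integrableExpSet id (expFamilyLaw ν a b c t)) := by
  have : integrableExpSet id (expFamilyLaw ν a b c t) = Set.univ :=
    Set.eq_univ_of_forall fun s ↦ h.integrable_exp_mul t s
  simp [this]

lemma integrable_id (h : IsNaturalExpFamily ν a b c) (t : ℝ) :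
    Integrable (fun y ↦ y) (expFamilyLaw ν a b c t) :=
  integrable_of_mem_interior_integrableExpSet (h.zero_mem_interior_integrableExpSet t)

lemma integral_id (h : IsNaturalExpFamily ν a b c) (t : ℝ) :
    ∫ y, y ∂(expFamilyLaw ν a b c t) = deriv b t := by
  have h1 := deriv_mgf_zero (h.zero_mem_interior_integrableExpSet t)
  simp only [id] at h1
  rw [← h1]
  have h2 : mgf id (expFamilyLaw ν a b c t) = fun s ↦ Real.exp ((b (t + a * s) - b t) / a) :=
    funext (h.mgf_eq t)
  have h3 : HasDerivAt (fun s ↦ t + a * s) a 0 := by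
    simpa using ((hasDerivAt_id (0 : ℝ)).const_mul a).const_add t
  have h4 : HasDerivAt b (deriv b t) (t + a * 0) := by
    simpa using (h.differentiable_b t).hasDerivAt
  have h5 := (((h4.comp 0 h3).sub_const (b t)).div_const a).exp
  rw [h2]
  refine h5.deriv.trans ?_
  have := h.scale_pos.ne'
  simp
  field_simp

end IsNaturalExpFamily

/-! ### Kullback-Leibler divergence in the generalized linear model -/

/-- The Kullback-Leibler divergence between the joint laws with natural parameters `θ` and `ζ`,
in closed form: the Bregman divergence of `b`, summed over the coordinates and divided by `a`. -/
noncomputable def bregmanKL {n : ℕ} (a : ℝ) (b : ℝ → ℝ) (θ ζ : Fin n → ℝ) : ℝ :=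
  ∑ i, (deriv b (θ i) * (θ i - ζ i) - (b (θ i) - b (ζ i))) / a

lemma isProbabilityMeasure_glmLaw {n : ℕ} {ν : Measure ℝ} {a : ℝ} {b c : ℝ → ℝ}
    (h : IsNaturalExpFamily ν a b c) (ζ : Fin n → ℝ) :
    IsProbabilityMeasure (glmLaw ν a b c ζ) := by
  have := h.isProbabilityMeasure
  unfold glmLaw
  infer_instance

theorem glmKL_eq_ofReal_bregmanKL {n : ℕ} {ν : Measure ℝ} {a : ℝ} {b c : ℝ → ℝ}
    (h : IsNaturalExpFamily ν a b c) (θ ζ : Fin n → ℝ) :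
    glmKL ν a b c θ ζ = ENNReal.ofReal (bregmanKL a b θ ζ) := by
  have hp := h.isProbabilityMeasure
  have hpθ := isProbabilityMeasure_glmLaw h θ
  have hpζ := isProbabilityMeasure_glmLaw h ζ
  set g : (Fin n → ℝ) → ℝ :=
    fun y ↦ ∑ i, (y i * (θ i - ζ i) - (b (θ i) - b (ζ i))) / a with hg
  have hgm : Measurable g := by fun_prop
  have hdens : glmLaw ν a b c θ
      = (glmLaw ν a b c ζ).withDensity fun y ↦ ENNReal.ofReal (Real.exp (g y)) := by
    have hsf : ∀ i, SigmaFinite ((expFamilyLaw ν a b c (ζ i)).withDensity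
        fun y ↦ ENNReal.ofReal (Real.exp ((y * (θ i - ζ i) - (b (θ i) - b (ζ i))) / a))) := by
      intro i
      rw [← h.law_eq_withDensity (θ i) (ζ i)]
      infer_instance
    have h1 : glmLaw ν a b c θ = Measure.pi fun i ↦ (expFamilyLaw ν a b c (ζ i)).withDensity
        fun y ↦ ENNReal.ofReal (Real.exp ((y * (θ i - ζ i) - (b (θ i) - b (ζ i))) / a)) := by
      unfold glmLaw
      congr 1
      funext i
      exact h.law_eq_withDensity (θ i) (ζ i)
    rw [h1, pi_withDensity (fun i ↦ by fun_prop)]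
    unfold glmLaw
    congr 1
    funext y
    rw [hg, Real.exp_sum, ENNReal.ofReal_prod_of_nonneg fun _ _ ↦ (Real.exp_pos _).le]
  have hterm : ∀ i, Integrable
      (fun y : Fin n → ℝ ↦ (y i * (θ i - ζ i) - (b (θ i) - b (ζ i))) / a) (glmLaw ν a b c θ) := by
    intro i
    have h1 : Integrable (fun y : Fin n → ℝ ↦ y i) (glmLaw ν a b c θ) :=
      (measurePreserving_eval (fun i ↦ expFamilyLaw ν a b c (θ i)) i).integrable_comp_of_integrable
        (h.integrable_id (θ i))
    exact ((h1.mul_const _).sub (integrable_const _)).div_const _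
  have hint : Integrable g (glmLaw ν a b c θ) := integrable_finsetSum _ fun i _ ↦ hterm i
  have hval : ∫ y, g y ∂(glmLaw ν a b c θ) = bregmanKL a b θ ζ := by
    rw [hg, integral_finsetSum _ fun i _ ↦ hterm i]
    unfold bregmanKL
    refine Finset.sum_congr rfl fun i _ ↦ ?_
    have h2 : ∫ y : Fin n → ℝ, (y i * (θ i - ζ i) - (b (θ i) - b (ζ i))) / a ∂(glmLaw ν a b c θ)
        = ∫ y, (y * (θ i - ζ i) - (b (θ i) - b (ζ i))) / a ∂(expFamilyLaw ν a b c (θ i)) :=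
      integral_comp_eval (μ := fun i ↦ expFamilyLaw ν a b c (θ i))
        (f := fun y ↦ (y * (θ i - ζ i) - (b (θ i) - b (ζ i))) / a) (by fun_prop)
    rw [h2, integral_div, integral_sub ((h.integrable_id _).mul_const _) (integrable_const _),
      integral_mul_const, h.integral_id]
    simp
  unfold glmKL
  rw [← hval]
  rw [hdens] at hint hpθ ⊢
  exact klDiv_withDensity_exp _ hgm hint

/-! ### Quadratic bounds from the curvature of the cumulant function -/

lemma add_deriv_mul_add_sq_le {f : ℝ → ℝ} {s : Set ℝ} {m x y : ℝ} (hs : s.OrdConnected)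
    (hf : Differentiable ℝ f) (hf' : Differentiable ℝ (deriv f))
    (hm : ∀ z ∈ s, m ≤ deriv (deriv f) z) (hx : x ∈ s) (hy : y ∈ s) :
    f x + deriv f x * (y - x) + m / 2 * (y - x) ^ 2 ≤ f y := by
  have hd : ∀ z, HasDerivAt (fun z ↦ f z - m / 2 * z ^ 2) (deriv f z - m * z) z := by
    intro z
    convert! (hf z).hasDerivAt.sub (((hasDerivAt_id z).pow 2).const_mul (m / 2)) using 1
    simp
    ring
  have hd' : deriv (fun z ↦ f z - m / 2 * z ^ 2) = fun z ↦ deriv f z - m * z :=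
    funext fun z ↦ (hd z).deriv
  have hd2 : ∀ z, HasDerivAt (fun z ↦ deriv f z - m * z) (deriv (deriv f) z - m) z := by
    intro z
    convert! (hf' z).hasDerivAt.sub ((hasDerivAt_id z).const_mul m) using 1
    simp
  have hconv : ConvexOn ℝ s fun z ↦ f z - m / 2 * z ^ 2 := by
    refine convexOn_of_deriv2_nonneg' hs.convex
      (fun z _ ↦ (hd z).differentiableAt.differentiableWithinAt) ?_ ?_
    · rw [hd']
      exact fun z _ ↦ (hd2 z).differentiableAt.differentiableWithinAt
    · intro z hz
      rw [Function.iterate_succ, Function.iterate_one, Function.comp_apply, hd', (hd2 z).deriv]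
      linarith [hm z hz]
  rcases lt_trichotomy x y with h | h | h
  · have h1 := hconv.le_slope_of_hasDerivAt hx hy h (hd x)
    rw [slope_def_field, le_div_iff₀ (by linarith)] at h1
    nlinarith
  · subst h
    simp
  · have h1 := hconv.slope_le_of_hasDerivAt hy hx h (hd x)
    rw [slope_def_field, div_le_iff₀ (by linarith)] at h1
    nlinarith

namespace CurvatureAssumption

variable {ν : Measure ℝ} {a : ℝ} {b c : ℝ → ℝ} {Θ : Set ℝ} {Lo Up : ℝ}

lemma up_pos (hA : CurvatureAssumption b Θ Lo Up) : 0 < Up := hA.lo_pos.trans_le hA.lo_le_up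

lemma le_add_deriv_mul_add_sq (hA : CurvatureAssumption b Θ Lo Up)
    (h : IsNaturalExpFamily ν a b c) (x y : ℝ) :
    b y ≤ b x + deriv b x * (y - x) + Up / 2 * (y - x) ^ 2 := by
  have hn : deriv (fun z ↦ -b z) = fun z ↦ -deriv b z := funext fun z ↦ deriv.fun_neg
  have h1 := add_deriv_mul_add_sq_le (f := fun z ↦ -b z) (m := -Up) (x := x) (y := y)
    Set.ordConnected_univ h.differentiable_b.fun_neg
    (by rw [hn]; exact h.differentiable_deriv_b.fun_neg)
    (fun z _ ↦ by
      rw [hn, deriv.fun_neg]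
      linarith [hA.deriv2_le z]) (Set.mem_univ x) (Set.mem_univ y)
  rw [hn] at h1
  linarith

/-- On `Θ`, the divergence dominates the squared Euclidean distance of the parameters. -/
lemma sq_dist_le_bregmanKL (hA : CurvatureAssumption b Θ Lo Up)
    (h : IsNaturalExpFamily ν a b c) {n : ℕ} {θ ζ : Fin n → ℝ} (hθ : ∀ i, θ i ∈ Θ)
    (hζ : ∀ i, ζ i ∈ Θ) :
    Lo / (2 * a) * ∑ i, (ζ i - θ i) ^ 2 ≤ bregmanKL a b θ ζ := by
  unfold bregmanKL
  rw [Finset.mul_sum]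
  refine Finset.sum_le_sum fun i _ ↦ ?_
  have h1 := add_deriv_mul_add_sq_le hA.ordConnected h.differentiable_b h.differentiable_deriv_b
    hA.le_deriv2 (hθ i) (hζ i)
  have ha := h.scale_pos
  rw [show Lo / (2 * a) * (ζ i - θ i) ^ 2 = Lo / 2 * (ζ i - θ i) ^ 2 / a by field_simp]
  gcongr
  linarith

/-- The centred observations are jointly sub-Gaussian with variance proxy `a * Up`. -/
lemma lintegral_exp_noise_le (hA : CurvatureAssumption b Θ Lo Up)
    (h : IsNaturalExpFamily ν a b c) {n : ℕ} (θ v : Fin n → ℝ) :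
    ∫⁻ y, ENNReal.ofReal (Real.exp (∑ i, v i * (y i - deriv b (θ i)))) ∂(glmLaw ν a b c θ)
      ≤ ENNReal.ofReal (Real.exp (a * Up / 2 * ∑ i, v i ^ 2)) := by
  have hp := h.isProbabilityMeasure
  have ha := h.scale_pos
  rw [Finset.mul_sum]
  simp_rw [Real.exp_sum, ENNReal.ofReal_prod_of_nonneg fun _ _ ↦ (Real.exp_pos _).le]
  unfold glmLaw
  rw [lintegral_pi_prod (f := fun i y ↦ ENNReal.ofReal (Real.exp (v i * (y - deriv b (θ i)))))
    fun i ↦ by fun_prop]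
  refine Finset.prod_le_prod' fun i _ ↦ ?_
  have h1 : ∀ y, ENNReal.ofReal (Real.exp (v i * (y - deriv b (θ i))))
      = ENNReal.ofReal (Real.exp (-(v i * deriv b (θ i)))) *
        ENNReal.ofReal (Real.exp (v i * y)) := by
    intro y
    rw [← ENNReal.ofReal_mul (Real.exp_pos _).le, ← Real.exp_add]
    congr 2
    ring
  simp_rw [h1]
  rw [lintegral_const_mul _ (by fun_prop), h.lintegral_exp_mul,
    ← ENNReal.ofReal_mul (Real.exp_pos _).le, ← Real.exp_add]
  refine ENNReal.ofReal_le_ofReal (Real.exp_le_exp.2 ?_)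
  have h2 := hA.le_add_deriv_mul_add_sq h (θ i) (θ i + a * v i)
  have h3 : (b (θ i + a * v i) - b (θ i)) / a
      ≤ (deriv b (θ i) * (a * v i) + Up / 2 * (a * v i) ^ 2) / a := by
    gcongr
    simp only [add_sub_cancel_left] at h2
    linarith
  have h4 : (deriv b (θ i) * (a * v i) + Up / 2 * (a * v i) ^ 2) / a
      = deriv b (θ i) * v i + a * Up / 2 * v i ^ 2 := by
    field_simp
  linarith

end CurvatureAssumption

/-! ### Exponential moments of quadratic forms in sub-Gaussian noise -/

/-- An orthonormal basis of a subspace of `ℝⁿ`, in coordinates. -/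
lemma exists_orthonormal_spanning {n : ℕ} (W : Submodule ℝ (Fin n → ℝ)) :
    ∃ u : Fin (Module.finrank ℝ W) → Fin n → ℝ,
      (∀ g : Fin (Module.finrank ℝ W) → ℝ, ∑ i, (∑ j, g j * u j i) ^ 2 = ∑ j, g j ^ 2) ∧
      ∀ w ∈ W, ∃ g : Fin (Module.finrank ℝ W) → ℝ, ∀ i, w i = ∑ j, g j * u j i := by
  set e : (Fin n → ℝ) ≃ₗ[ℝ] EuclideanSpace ℝ (Fin n) := (WithLp.linearEquiv 2 ℝ (Fin n → ℝ)).symm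
    with he
  set W' := W.map e.toLinearMap with hW'
  have hdim : Module.finrank ℝ W' = Module.finrank ℝ W := LinearEquiv.finrank_map_eq e W
  set o := (stdOrthonormalBasis ℝ W').reindex (finCongr hdim) with ho
  have hcoord : ∀ g : Fin (Module.finrank ℝ W) → ℝ, ∀ i,
      ((∑ j, g j • o j : W') : EuclideanSpace ℝ (Fin n)) i
        = ∑ j, g j * (o j : EuclideanSpace ℝ (Fin n)) i := by
    intro g i
    simp
  refine ⟨fun j i ↦ (o j : EuclideanSpace ℝ (Fin n)) i, fun g ↦ ?_, fun w hw ↦ ?_⟩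
  · have h1 : ‖(∑ j, g j • o j : W')‖ ^ 2 = ∑ j, g j ^ 2 := by
      rw [← o.sum_sq_inner_right]
      refine Finset.sum_congr rfl fun j _ ↦ ?_
      rw [o.orthonormal.inner_right_fintype]
    rw [← h1, Submodule.coe_norm, EuclideanSpace.real_norm_sq_eq]
    exact Finset.sum_congr rfl fun i _ ↦ by rw [hcoord]
  · have hw' : e w ∈ W' := Submodule.mem_map_of_mem hw
    refine ⟨fun j ↦ o.repr ⟨e w, hw'⟩ j, fun i ↦ ?_⟩
    rw [← hcoord, o.sum_repr]
    rfl

lemma lintegral_exp_mul_gaussianReal (t : ℝ) :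
    ∫⁻ g, ENNReal.ofReal (Real.exp (t * g)) ∂(gaussianReal 0 1)
      = ENNReal.ofReal (Real.exp (t ^ 2 / 2)) := by
  rw [← ofReal_integral_eq_lintegral_ofReal (integrable_exp_mul_gaussianReal t)
    (ae_of_all _ fun _ ↦ (Real.exp_pos _).le)]
  have h := congrFun (mgf_fun_id_gaussianReal (μ := 0) (v := 1)) t
  unfold mgf at h
  rw [h]
  simp

lemma lintegral_exp_sq_gaussianReal {s : ℝ} (hs : s < 1) :
    ∫⁻ g, ENNReal.ofReal (Real.exp (s / 2 * g ^ 2)) ∂(gaussianReal 0 1)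
      = ENNReal.ofReal (√(1 - s))⁻¹ := by
  rw [gaussianReal_of_var_ne_zero _ one_ne_zero,
    lintegral_withDensity_eq_lintegral_mul _ (measurable_gaussianPDF _ _) (by fun_prop)]
  have h1 : ∀ g : ℝ, (gaussianPDF 0 1 * fun g ↦ ENNReal.ofReal (Real.exp (s / 2 * g ^ 2))) g
      = ENNReal.ofReal ((√(2 * Real.pi))⁻¹ * Real.exp (-((1 - s) / 2) * g ^ 2)) := by
    intro g
    rw [Pi.mul_apply, gaussianPDF, gaussianPDFReal, ← ENNReal.ofReal_mul (by positivity),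
      mul_assoc, ← Real.exp_add]
    congr 2
    · simp
    · congr 1
      simp
      ring
  simp_rw [h1]
  rw [← ofReal_integral_eq_lintegral_ofReal
    ((integrable_exp_neg_mul_sq (by linarith)).const_mul _) (ae_of_all _ fun _ ↦ by positivity),
    integral_const_mul, integral_gaussian]
  congr 1
  rw [← Real.sqrt_inv, ← Real.sqrt_mul (by positivity), ← Real.sqrt_inv]
  congr 1
  have : (1 - s) ≠ 0 := by linarith
  field_simp

/-- A squared projection of sub-Gaussian noise onto a `d`-dimensional subspace has the exponential
moments of a chi-square variable with `d` degrees of freedom. The exponential of the square is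
linearised as a Gaussian mixture of exponentials of linear forms, and the two integrations are
exchanged. -/
lemma lintegral_exp_sum_sq_le {n d : ℕ} {μ : Measure (Fin n → ℝ)} [SFinite μ] {v : ℝ} (hv : 0 < v)
    {m : Fin n → ℝ}
    (hμ : ∀ w : Fin n → ℝ, ∫⁻ y, ENNReal.ofReal (Real.exp (∑ i, w i * (y i - m i))) ∂μ
      ≤ ENNReal.ofReal (Real.exp (v / 2 * ∑ i, w i ^ 2)))
    {u : Fin d → Fin n → ℝ}
    (hu : ∀ g : Fin d → ℝ, ∑ i, (∑ j, g j * u j i) ^ 2 = ∑ j, g j ^ 2)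
    {s : ℝ} (hs0 : 0 ≤ s) (hs1 : s < 1) :
    ∫⁻ y, ENNReal.ofReal (Real.exp (s / (2 * v) * ∑ j, (∑ i, u j i * (y i - m i)) ^ 2)) ∂μ
      ≤ ENNReal.ofReal ((√(1 - s))⁻¹ ^ d) := by
  set γ : Measure (Fin d → ℝ) := Measure.pi fun _ ↦ gaussianReal 0 1 with hγ
  set r : ℝ := √(s / v) with hr
  have hr2 : r ^ 2 = s / v := Real.sq_sqrt (by positivity)
  have hlin : ∀ y : Fin n → ℝ,
      ENNReal.ofReal (Real.exp (s / (2 * v) * ∑ j, (∑ i, u j i * (y i - m i)) ^ 2))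
        = ∫⁻ g, ENNReal.ofReal
            (Real.exp (∑ i, (∑ j, (r * g j) * u j i) * (y i - m i))) ∂γ := by
    intro y
    have h1 : ∀ g : Fin d → ℝ, ENNReal.ofReal
        (Real.exp (∑ i, (∑ j, (r * g j) * u j i) * (y i - m i)))
        = ∏ j, ENNReal.ofReal (Real.exp ((r * ∑ i, u j i * (y i - m i)) * g j)) := by
      intro g
      rw [← ENNReal.ofReal_prod_of_nonneg fun _ _ ↦ (Real.exp_pos _).le, ← Real.exp_sum]
      congr 2
      simp_rw [Finset.sum_mul, Finset.mul_sum, Finset.sum_mul]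
      rw [Finset.sum_comm]
      exact Finset.sum_congr rfl fun j _ ↦ Finset.sum_congr rfl fun i _ ↦ by ring
    simp_rw [h1]
    rw [hγ, lintegral_pi_prod
      (f := fun j g ↦ ENNReal.ofReal (Real.exp ((r * ∑ i, u j i * (y i - m i)) * g)))
      fun j ↦ by fun_prop]
    simp_rw [lintegral_exp_mul_gaussianReal]
    rw [← ENNReal.ofReal_prod_of_nonneg fun _ _ ↦ (Real.exp_pos _).le, ← Real.exp_sum,
      Finset.mul_sum]
    congr 2
    refine Finset.sum_congr rfl fun j _ ↦ ?_
    rw [mul_pow, hr2]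
    field_simp
  simp_rw [hlin]
  rw [lintegral_lintegral_swap (by fun_prop)]
  calc ∫⁻ g, ∫⁻ y, ENNReal.ofReal
          (Real.exp (∑ i, (∑ j, (r * g j) * u j i) * (y i - m i))) ∂μ ∂γ
      ≤ ∫⁻ g, ∏ j, ENNReal.ofReal (Real.exp (s / 2 * g j ^ 2)) ∂γ := by
        refine lintegral_mono fun g ↦ (hμ _).trans (le_of_eq ?_)
        rw [hu fun j ↦ r * g j, ← ENNReal.ofReal_prod_of_nonneg fun _ _ ↦ (Real.exp_pos _).le,
          ← Real.exp_sum, Finset.mul_sum]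
        congr 2
        refine Finset.sum_congr rfl fun j _ ↦ ?_
        rw [mul_pow, hr2]
        field_simp
    _ = ENNReal.ofReal ((√(1 - s))⁻¹ ^ d) := by
        rw [hγ, lintegral_pi_prod (f := fun _ g ↦ ENNReal.ofReal (Real.exp (s / 2 * g ^ 2)))
          fun j ↦ by fun_prop]
        simp_rw [lintegral_exp_sq_gaussianReal hs1]
        rw [Finset.prod_const, Finset.card_univ, Fintype.card_fin, ENNReal.ofReal_pow (by positivity)]

/-! ### Excess of the noise over the penalty in one model -/

lemma inv_sqrt_one_sub_le_exp {s : ℝ} (h0 : 0 ≤ s) (h1 : s ≤ 1 / 2) :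
    (√(1 - s))⁻¹ ≤ Real.exp ((s + s ^ 2) / 2) := by
  have h2 : 1 ≤ (1 - s) * Real.exp (s + s ^ 2) := by
    have h3 := Real.quadratic_le_exp_of_nonneg (x := s + s ^ 2) (by positivity)
    have h4 : 2 * s ≤ (1 - s) * (1 + s) ^ 2 := by nlinarith
    have h5 : s ^ 2 * (2 * s) ≤ s ^ 2 * ((1 - s) * (1 + s) ^ 2) := by gcongr
    have h6 : 1 ≤ (1 - s) * (1 + (s + s ^ 2) + (s + s ^ 2) ^ 2 / 2) := by nlinarith
    have h7 : (1 - s) * (1 + (s + s ^ 2) + (s + s ^ 2) ^ 2 / 2)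
        ≤ (1 - s) * Real.exp (s + s ^ 2) := by
      have : 0 ≤ 1 - s := by linarith
      gcongr
    linarith
  have hpos : 0 < 1 - s := by linarith
  rw [inv_le_iff_one_le_mul₀' (Real.sqrt_pos.2 hpos), Real.exp_half,
    ← Real.sqrt_mul hpos.le]
  exact Real.one_le_sqrt.2 h2

/-- The choice of the exponential tilt. The left-hand side is the Chernoff bound for the
expected excess of a chi-square variable with `k + 1` degrees of freedom, shifted by `2`, over
`k * (A + 2 * √(2 * l) + 4 * l)`. -/
lemma exists_tilt {k : ℕ} {l A : ℝ} (hl : 0 < l) (hA : 1 < A) :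
    ∃ s : ℝ, 0 < s ∧ s < 1 ∧
      2 / s * Real.exp (s / 2 * (2 - k * (A + 2 * √(2 * l) + 4 * l)) - 1)
          * (√(1 - s))⁻¹ ^ (k + 1)
        ≤ 2 * ((2 * A - 1) / (A - 1)) * Real.exp (-(k * l)) := by
  set m := √(2 * l) with hm
  have hm0 : 0 ≤ m := Real.sqrt_nonneg _
  have hm2 : m ^ 2 = 2 * l := Real.sq_sqrt (by linarith)
  have hδ : 0 < A - 1 := by linarith
  -- `s = m + (A - 1)` makes the exponent per dimension at most `-l`; the cap at `1 / 2` keeps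
  -- `(1 - s)⁻¹` bounded and costs nothing.
  obtain ⟨s, hs0, hs1, hquad, hinv⟩ : ∃ s : ℝ, 0 < s ∧ s ≤ 1 / 2 ∧
      (s - m) ^ 2 ≤ s * (A - 1) + 2 * s * m ^ 2 ∧
      2 / s ≤ 2 * ((2 * A - 1) / (A - 1)) := by
    have hrat : 2 * ((2 * A - 1) / (A - 1)) = 4 + 2 / (A - 1) := by
      field_simp
      ring
    have hpos : 0 < 2 / (A - 1) := by positivity
    rcases le_total (m + (A - 1)) (1 / 2) with h | h
    · refine ⟨m + (A - 1), by linarith, h, ?_, ?_⟩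
      · have : 0 ≤ 2 * (m + (A - 1)) * m ^ 2 := by positivity
        nlinarith
      · rw [hrat]
        have : 2 / (m + (A - 1)) ≤ 2 / (A - 1) := by
          gcongr
          linarith
        linarith
    · refine ⟨1 / 2, by norm_num, le_rfl, ?_, ?_⟩
      · nlinarith
      · rw [hrat]
        norm_num
        linarith
  refine ⟨s, hs0, by linarith, ?_⟩
  have hroot : (√(1 - s))⁻¹ ≤ √2 := by
    rw [← Real.sqrt_inv]
    refine Real.sqrt_le_sqrt ?_
    rw [inv_le_comm₀ (by linarith) (by norm_num)]
    linarith
  have hexp : √2 * Real.exp (s - 1) ≤ 1 := by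
    have h1 : Real.exp (s - 1) ≤ Real.exp (-1 / 2) := Real.exp_le_exp.2 (by linarith)
    have h2 : √2 ≤ Real.exp (1 / 2) := by
      rw [Real.exp_half]
      refine Real.sqrt_le_sqrt ?_
      have := Real.add_one_le_exp (1 : ℝ)
      linarith
    calc √2 * Real.exp (s - 1) ≤ Real.exp (1 / 2) * Real.exp (-1 / 2) := by gcongr
      _ = 1 := by rw [← Real.exp_add]; norm_num
  have hpow : (√(1 - s))⁻¹ ^ k ≤ Real.exp (k * ((s + s ^ 2) / 2)) := by
    rw [Real.exp_nat_mul]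
    gcongr
    exact inv_sqrt_one_sub_le_exp hs0.le hs1
  calc 2 / s * Real.exp (s / 2 * (2 - k * (A + 2 * m + 4 * l)) - 1) * (√(1 - s))⁻¹ ^ (k + 1)
      ≤ 2 / s * Real.exp (s / 2 * (2 - k * (A + 2 * m + 4 * l)) - 1)
          * (Real.exp (k * ((s + s ^ 2) / 2)) * √2) := by
        rw [pow_succ]
        gcongr
    _ = 2 / s * (√2 * Real.exp (s - 1))
          * Real.exp (k * ((s ^ 2 - s * (A - 1)) / 2 - s * m - 2 * s * l)) := by
        have : Real.exp (s / 2 * (2 - k * (A + 2 * m + 4 * l)) - 1)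
              * Real.exp (k * ((s + s ^ 2) / 2))
            = Real.exp (s - 1)
              * Real.exp (k * ((s ^ 2 - s * (A - 1)) / 2 - s * m - 2 * s * l)) := by
          rw [← Real.exp_add, ← Real.exp_add]
          congr 1
          ring
        linear_combination (2 / s * √2) * this
    _ ≤ 2 / s * 1 * Real.exp (k * (-l)) := by
        gcongr
        nlinarith
    _ ≤ 2 * ((2 * A - 1) / (A - 1)) * Real.exp (-(k * l)) := by
        rw [mul_one, mul_neg]
        gcongr

section NoiseExcess

variable {ν : Measure ℝ} {a : ℝ} {b c : ℝ → ℝ} {Θ : Set ℝ} {Lo Up : ℝ}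

/-- For a fixed subspace of dimension at most `k + 1`, the noise in the direction of any `w` in the
subspace is absorbed by a small multiple of `‖w‖²` and by the penalty, even with `4 * (Up / Lo)` to
spare, up to an excess whose expectation is of order `exp (-(k * l))`. -/
lemma exists_noise_excess (hA : CurvatureAssumption b Θ Lo Up) (h : IsNaturalExpFamily ν a b c)
    {n : ℕ} (θ : Fin n → ℝ) {A l pen : ℝ} (hA1 : 1 < A) (hl : 0 < l) {k : ℕ}
    (hpen : 2 * (Up / Lo) * k * (A + 2 * √(2 * l) + 4 * l) ≤ pen)
    (W : Submodule ℝ (Fin n → ℝ)) (hW : Module.finrank ℝ W ≤ k + 1) :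
    ∃ Z : (Fin n → ℝ) → ℝ, Measurable Z ∧ (∀ y, 0 ≤ Z y) ∧
      ∫⁻ y, ENNReal.ofReal (Z y) ∂(glmLaw ν a b c θ)
        ≤ ENNReal.ofReal (4 * (Up / Lo) * ((2 * A - 1) / (A - 1)) * Real.exp (-(k * l))) ∧
      ∀ y, ∀ w ∈ W, (1 / a) * ∑ i, w i * (y i - deriv b (θ i))
        ≤ Lo / (8 * a) * ∑ i, w i ^ 2 + pen - 4 * (Up / Lo) + Z y := by
  have ha := h.scale_pos
  have hLo := hA.lo_pos
  have hUp := hA.up_pos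
  have hprob := isProbabilityMeasure_glmLaw h θ
  obtain ⟨s, hs0, hs1, hs⟩ := exists_tilt (k := k) hl hA1
  obtain ⟨u, hu, hspan⟩ := exists_orthonormal_spanning W
  set t : ℝ := k * (A + 2 * √(2 * l) + 4 * l) with ht
  set Q : (Fin n → ℝ) → ℝ := fun y ↦ ∑ j, (∑ i, u j i * (y i - deriv b (θ i))) ^ 2 with hQ
  have hQm : Measurable Q := by fun_prop
  set κ : ℝ := 2 * (Up / Lo) * (2 / s) * Real.exp (s / 2 * (2 - t) - 1) with hκ
  have hκ0 : 0 ≤ κ := by positivity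
  refine ⟨fun y ↦ κ * Real.exp (s / (2 * (a * Up)) * Q y), by fun_prop,
    fun y ↦ by positivity, ?_, ?_⟩
  · simp_rw [ENNReal.ofReal_mul hκ0]
    rw [lintegral_const_mul _ (by fun_prop)]
    have hmgf := lintegral_exp_sum_sq_le (mul_pos ha hUp) (hA.lintegral_exp_noise_le h θ) hu
      hs0.le hs1
    have hone : 1 ≤ (√(1 - s))⁻¹ := by
      rw [one_le_inv₀ (Real.sqrt_pos.2 (by linarith))]
      exact Real.sqrt_le_one.2 (by linarith)
    refine (mul_le_mul_right hmgf _).trans ?_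
    rw [← ENNReal.ofReal_mul hκ0]
    refine ENNReal.ofReal_le_ofReal ?_
    calc κ * (√(1 - s))⁻¹ ^ Module.finrank ℝ W ≤ κ * (√(1 - s))⁻¹ ^ (k + 1) := by
          gcongr
      _ = 2 * (Up / Lo) * (2 / s * Real.exp (s / 2 * (2 - t) - 1) * (√(1 - s))⁻¹ ^ (k + 1)) := by
          rw [hκ]
          ring
      _ ≤ 2 * (Up / Lo) * (2 * ((2 * A - 1) / (A - 1)) * Real.exp (-(k * l))) := by
          gcongr
      _ = _ := by ring
  · intro y w hw
    obtain ⟨g, hg⟩ := hspan w hw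
    have h1 : ∑ i, w i * (y i - deriv b (θ i))
        = ∑ j, g j * ∑ i, u j i * (y i - deriv b (θ i)) := by
      simp_rw [hg, Finset.sum_mul, Finset.mul_sum]
      rw [Finset.sum_comm]
      exact Finset.sum_congr rfl fun j _ ↦ Finset.sum_congr rfl fun i _ ↦ by ring
    have h2 : ∑ i, w i ^ 2 = ∑ j, g j ^ 2 := by
      simp_rw [hg]
      exact hu g
    have h3 : (1 / a) * ∑ i, w i * (y i - deriv b (θ i))
        ≤ Lo / (8 * a) * ∑ i, w i ^ 2 + 2 / (a * Lo) * Q y := by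
      rw [h1, h2, show Q y = ∑ j, (∑ i, u j i * (y i - deriv b (θ i))) ^ 2 from rfl,
        Finset.mul_sum, Finset.mul_sum, Finset.mul_sum, ← Finset.sum_add_distrib]
      refine Finset.sum_le_sum fun j _ ↦ ?_
      set q := ∑ i, u j i * (y i - deriv b (θ i))
      have h4 : Lo / (8 * a) * g j ^ 2 + 2 / (a * Lo) * q ^ 2 - 1 / a * (g j * q)
          = (Lo * g j - 4 * q) ^ 2 / (8 * a * Lo) := by
        field_simp
        ring
      have h5 : 0 ≤ (Lo * g j - 4 * q) ^ 2 / (8 * a * Lo) := by positivity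
      linarith
    have h6 : s / 2 * (Q y / (a * Up) + 2 - t)
        ≤ Real.exp (s / 2 * (2 - t) - 1) * Real.exp (s / (2 * (a * Up)) * Q y) := by
      rw [← Real.exp_add]
      have h7 := Real.add_one_le_exp (s / 2 * (2 - t) - 1 + s / (2 * (a * Up)) * Q y)
      refine le_trans (le_of_eq ?_) h7
      field_simp
      ring
    have h8 : 2 * (Up / Lo) * (Q y / (a * Up) + 2 - t)
        ≤ κ * Real.exp (s / (2 * (a * Up)) * Q y) := by
      have h9 : 2 * (Up / Lo) * (2 / s) * (s / 2 * (Q y / (a * Up) + 2 - t))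
          ≤ 2 * (Up / Lo) * (2 / s) *
            (Real.exp (s / 2 * (2 - t) - 1) * Real.exp (s / (2 * (a * Up)) * Q y)) := by
        gcongr
      calc 2 * (Up / Lo) * (Q y / (a * Up) + 2 - t)
          = 2 * (Up / Lo) * (2 / s) * (s / 2 * (Q y / (a * Up) + 2 - t)) := by
            field_simp
        _ ≤ _ := h9
        _ = _ := by rw [hκ]; ring
    have h10 : 2 * (Up / Lo) * (Q y / (a * Up) + 2 - t)
        = 2 / (a * Lo) * Q y + 4 * (Up / Lo) - 2 * (Up / Lo) * t := by
      field_simp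
      ring
    have h11 : 2 * (Up / Lo) * t ≤ pen := by
      rw [ht]
      linarith
    linarith

/-- For the empty model the noise has a single direction, that of `θ`, and no penalty is available.
The expectation of the excess matches the amount `4 * (Up / Lo)` spared by the other models. -/
lemma exists_noise_excess_empty (hA : CurvatureAssumption b Θ Lo Up)
    (h : IsNaturalExpFamily ν a b c) {n : ℕ} (θ : Fin n → ℝ) :
    ∃ Z : (Fin n → ℝ) → ℝ, Measurable Z ∧ (∀ y, 0 ≤ Z y) ∧
      ∫⁻ y, ENNReal.ofReal (Z y) ∂(glmLaw ν a b c θ) ≤ ENNReal.ofReal (4 * (Up / Lo)) ∧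
      ∀ y, (1 / a) * ∑ i, (0 - θ i) * (y i - deriv b (θ i))
        ≤ Lo / (8 * a) * ∑ i, (0 - θ i) ^ 2 - 4 * (Up / Lo) + Z y := by
  have ha := h.scale_pos
  have hLo := hA.lo_pos
  have hUp := hA.up_pos
  set ρ : ℝ := 4 * (Up / Lo) with hρ
  have hρ0 : 0 < ρ := by positivity
  set V : ℝ := ∑ i, (0 - θ i) ^ 2 with hV
  set κ : ℝ := ρ * Real.exp (-(Lo / (8 * a) * V / ρ)) with hκ
  have hκ0 : 0 ≤ κ := by positivity
  refine ⟨fun y ↦ κ * Real.exp (∑ i, ((0 - θ i) / (a * ρ)) * (y i - deriv b (θ i))),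
    by fun_prop, fun y ↦ by positivity, ?_, fun y ↦ ?_⟩
  · simp_rw [ENNReal.ofReal_mul hκ0]
    rw [lintegral_const_mul _ (by fun_prop)]
    refine (mul_le_mul_right (hA.lintegral_exp_noise_le h θ _) _).trans ?_
    rw [← ENNReal.ofReal_mul hκ0]
    refine ENNReal.ofReal_le_ofReal (le_of_eq ?_)
    rw [hκ, mul_assoc, ← Real.exp_add]
    have h1 : ∑ i, ((0 - θ i) / (a * ρ)) ^ 2 = V / (a * ρ) ^ 2 := by
      simp_rw [div_pow]
      rw [← Finset.sum_div]
    rw [h1]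
    have h2 : -(Lo / (8 * a) * V / ρ) + a * Up / 2 * (V / (a * ρ) ^ 2) = 0 := by
      rw [hρ]
      field_simp
      ring
    rw [h2, Real.exp_zero, mul_one]
  · set q := ∑ i, (0 - θ i) * (y i - deriv b (θ i)) with hq
    have h1 : ∑ i, ((0 - θ i) / (a * ρ)) * (y i - deriv b (θ i)) = q / (a * ρ) := by
      rw [hq, Finset.sum_div]
      exact Finset.sum_congr rfl fun i _ ↦ by ring
    simp only
    rw [h1, hκ, mul_assoc, ← Real.exp_add]
    have h2 := Real.add_one_le_exp (-(Lo / (8 * a) * V / ρ) + q / (a * ρ))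
    have h3 : ρ * (-(Lo / (8 * a) * V / ρ) + q / (a * ρ) + 1)
        = -(Lo / (8 * a) * V) + 1 / a * q + ρ := by
      field_simp
    have h4 := mul_le_mul_of_nonneg_left h2 hρ0.le
    linarith

/-! ### Excess over all models and the oracle inequality -/

lemma finrank_span_singleton_sup_le {n k : ℕ} (θ : Fin n → ℝ) (V : Submodule ℝ (Fin n → ℝ))
    (hV : Module.finrank ℝ V ≤ k) :
    Module.finrank ℝ (Submodule.span ℝ {θ} ⊔ V : Submodule ℝ (Fin n → ℝ)) ≤ k + 1 := by
  have h1 := Submodule.finrank_add_le_finrank_add_finrank (Submodule.span ℝ {θ}) V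
  have h2 := finrank_span_le_card (R := ℝ) ({θ} : Set (Fin n → ℝ))
  simp only [Set.toFinset_singleton, Finset.card_singleton] at h2
  omega

lemma mulVec_mem_span_columns {n p : ℕ} (X : Matrix (Fin n) (Fin p) ℝ) {M : Finset (Fin p)}
    {β : Fin p → ℝ} (hβ : ∀ j, j ∉ M → β j = 0) :
    X.mulVec β ∈ Submodule.span ℝ (M.image X.col : Set (Fin n → ℝ)) := by
  have h1 : X.mulVec β = ∑ j, β j • X.col j := by
    ext i
    simp [Matrix.mulVec, dotProduct, mul_comm]
  rw [h1]
  refine Submodule.sum_mem _ fun j _ ↦ ?_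
  by_cases hj : j ∈ M
  · exact Submodule.smul_mem _ _ (Submodule.subset_span
      (Finset.mem_coe.2 (Finset.mem_image_of_mem X.col hj)))
  · simp [hβ j hj]

/-- Summing a function of the size over the nonempty sets of less than `r` predictors. -/
lemma sum_filter_card {p r : ℕ} (f : ℕ → ℝ) :
    ∑ M : Finset (Fin p) with M.card ∈ Finset.Ico 1 r, f M.card
      = ∑ k ∈ Finset.Ico 1 r, (p.choose k : ℝ) * f k := by
  rw [← Finset.sum_fiberwise_of_maps_to (t := Finset.Ico 1 r) (g := Finset.card)
    fun M hM ↦ (Finset.mem_filter.1 hM).2]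
  refine Finset.sum_congr rfl fun k hk ↦ ?_
  have h1 : ({M ∈ ({M : Finset (Fin p) | M.card ∈ Finset.Ico 1 r} : Finset (Finset (Fin p)))
      | M.card = k} : Finset (Finset (Fin p))) = Finset.powersetCard k Finset.univ := by
    ext M
    simp only [Finset.mem_filter, Finset.mem_univ, true_and, Finset.mem_powersetCard,
      Finset.subset_univ]
    exact ⟨fun hM ↦ hM.2, fun hM ↦ ⟨hM ▸ hk, hM⟩⟩
  rw [h1, Finset.sum_congr rfl fun M hM ↦ by rw [(Finset.mem_powersetCard.1 hM).2],
    Finset.sum_const, Finset.card_powersetCard, Finset.card_univ, Fintype.card_fin, nsmul_eq_mul]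

/-- The noise in the direction `ζ - θ`, in the scale of the log-likelihood. -/
noncomputable def noise {n : ℕ} (a : ℝ) (b : ℝ → ℝ) (θ ζ y : Fin n → ℝ) : ℝ :=
  (1 / a) * ∑ i, (ζ i - θ i) * (y i - deriv b (θ i))

/-- The log-likelihood ratio is the negative divergence plus centred noise. -/
lemma logLik_sub_logLik {n : ℕ} (a : ℝ) (b : ℝ → ℝ) (θ ζ y : Fin n → ℝ) :
    logLik a b y ζ - logLik a b y θ = noise a b θ ζ y - bregmanKL a b θ ζ := by
  unfold logLik noise bregmanKL
  simp_rw [Finset.mul_sum]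
  rw [← Finset.sum_sub_distrib, ← Finset.sum_sub_distrib]
  exact Finset.sum_congr rfl fun i _ ↦ by ring

/-- One random excess `Z` serves all models simultaneously. All models of maximal size share the
column space of `X`, so they contribute a single term to the expectation of `Z`. -/
theorem exists_uniform_noise_excess (hA : CurvatureAssumption b Θ Lo Up)
    (h : IsNaturalExpFamily ν a b c) {n p : ℕ} (X : Matrix (Fin n) (Fin p) ℝ)
    {θ : Fin n → ℝ} (hθ : ∀ i, θ i ∈ Θ)
    {L : ℕ → ℝ} (hL : ∀ k, 1 ≤ k → k ≤ X.rank → 0 < L k) {S : ℝ}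
    (hS : ∑ k ∈ Finset.Ico 1 X.rank, (p.choose k : ℝ) * Real.exp (-(k * L k))
      + Real.exp (-(X.rank * L X.rank)) ≤ S)
    {A : ℝ} (hA1 : 1 < A) {Pen : ℕ → ℝ} (hPen0 : 0 ≤ Pen 0)
    (hPen : ∀ k : ℕ, 1 ≤ k → k ≤ X.rank →
      2 * (Up / Lo) * k * (A + 2 * √(2 * L k) + 4 * L k) ≤ Pen k) :
    ∃ Z : (Fin n → ℝ) → ℝ, Measurable Z ∧ (∀ y, 0 ≤ Z y) ∧
      ∫⁻ y, ENNReal.ofReal (Z y) ∂(glmLaw ν a b c θ) ≤ ENNReal.ofReal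
        (4 * (Up / Lo) + 4 * (Up / Lo) * ((2 * A - 1) / (A - 1)) * S) ∧
      ∀ y, ∀ M ∈ models X, ∀ β ∈ coeffSet X Θ M,
        noise a b θ (X.mulVec β) y ≤ bregmanKL a b θ (X.mulVec β) / 4 + Pen M.card
          - 4 * (Up / Lo) + Z y := by
  classical
  have ha := h.scale_pos
  have hLo := hA.lo_pos
  have hUp := hA.up_pos
  set C : ℝ := 4 * (Up / Lo) * ((2 * A - 1) / (A - 1)) with hC
  have hC0 : 0 ≤ C := by
    have : 0 < A - 1 := by linarith
    have : 0 < 2 * A - 1 := by linarith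
    positivity
  set r := X.rank with hr
  set F : Finset (Finset (Fin p)) := {M | M.card ∈ Finset.Ico 1 r} with hF
  -- Divergence in place of squared distance.
  have hquad : ∀ M, ∀ β ∈ coeffSet X Θ M,
      Lo / (8 * a) * ∑ i, (X.mulVec β i - θ i) ^ 2 ≤ bregmanKL a b θ (X.mulVec β) / 4 := by
    intro M β hβ
    have h1 := hA.sq_dist_le_bregmanKL h hθ hβ.2
    have h2 : Lo / (8 * a) = Lo / (2 * a) / 4 := by
      field_simp
      norm_num
    rw [h2, div_mul_eq_mul_div]
    gcongr
  obtain ⟨Z0, hZ0m, hZ0, hZ0int, hZ0le⟩ := exists_noise_excess_empty hA h θ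
  have hF' : ∀ M : Finset (Fin p), ∃ Z : (Fin n → ℝ) → ℝ, Measurable Z ∧ (∀ y, 0 ≤ Z y) ∧
      (M ∈ F → ∫⁻ y, ENNReal.ofReal (Z y) ∂(glmLaw ν a b c θ)
        ≤ ENNReal.ofReal (C * Real.exp (-(M.card * L M.card)))) ∧
      (M ∈ F → ∀ y, ∀ w ∈ Submodule.span ℝ {θ} ⊔ Submodule.span ℝ (M.image X.col : Set (Fin n → ℝ)),
        (1 / a) * ∑ i, w i * (y i - deriv b (θ i))
          ≤ Lo / (8 * a) * ∑ i, w i ^ 2 + Pen M.card - 4 * (Up / Lo) + Z y) := by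
    intro M
    by_cases hM : M ∈ F
    · have hM1 := Finset.mem_Ico.1 (Finset.mem_filter.1 hM).2
      obtain ⟨Z, h1, h2, h3, h4⟩ := exists_noise_excess hA h θ hA1 (hL M.card hM1.1 hM1.2.le)
        (hPen M.card hM1.1 hM1.2.le) _ (finrank_span_singleton_sup_le θ _
          ((finrank_span_finset_le_card (M.image X.col)).trans Finset.card_image_le))
      exact ⟨Z, h1, h2, fun _ ↦ h3, fun _ ↦ h4⟩
    · exact ⟨fun _ ↦ 0, measurable_const, fun _ ↦ le_rfl, fun h ↦ absurd h hM,
        fun h ↦ absurd h hM⟩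
  choose ZF hZFm hZF hZFint hZFle using hF'
  obtain ⟨Zr, hZrm, hZr, hZrint, hZrle⟩ : ∃ Z : (Fin n → ℝ) → ℝ, Measurable Z ∧ (∀ y, 0 ≤ Z y) ∧
      ∫⁻ y, ENNReal.ofReal (Z y) ∂(glmLaw ν a b c θ)
        ≤ ENNReal.ofReal (C * Real.exp (-(r * L r))) ∧
      (1 ≤ r → ∀ y, ∀ w ∈ Submodule.span ℝ {θ} ⊔ LinearMap.range X.mulVecLin,
        (1 / a) * ∑ i, w i * (y i - deriv b (θ i))
          ≤ Lo / (8 * a) * ∑ i, w i ^ 2 + Pen r - 4 * (Up / Lo) + Z y) := by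
    by_cases hr1 : 1 ≤ r
    · obtain ⟨Z, h1, h2, h3, h4⟩ := exists_noise_excess hA h θ hA1 (hL r hr1 le_rfl)
        (hPen r hr1 le_rfl) _ (finrank_span_singleton_sup_le θ (LinearMap.range X.mulVecLin) le_rfl)
      exact ⟨Z, h1, h2, h3, fun _ ↦ h4⟩
    · exact ⟨fun _ ↦ 0, measurable_const, fun _ ↦ le_rfl, by simp, fun h ↦ absurd h hr1⟩
  refine ⟨fun y ↦ Z0 y + (∑ M ∈ F, ZF M y + Zr y), by fun_prop, fun y ↦ ?_, ?_, ?_⟩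
  · exact add_nonneg (hZ0 y) (add_nonneg (Finset.sum_nonneg fun M _ ↦ hZF M y) (hZr y))
  · have hsplit : ∀ y, ENNReal.ofReal (Z0 y + (∑ M ∈ F, ZF M y + Zr y))
        = ENNReal.ofReal (Z0 y) + (∑ M ∈ F, ENNReal.ofReal (ZF M y) + ENNReal.ofReal (Zr y)) := by
      intro y
      rw [ENNReal.ofReal_add (hZ0 y) (add_nonneg (Finset.sum_nonneg fun M _ ↦ hZF M y) (hZr y)),
        ENNReal.ofReal_add (Finset.sum_nonneg fun M _ ↦ hZF M y) (hZr y),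
        ENNReal.ofReal_sum_of_nonneg fun M _ ↦ hZF M y]
    simp_rw [hsplit]
    rw [lintegral_add_left (by fun_prop), lintegral_add_right _ (by fun_prop),
      lintegral_finsetSum _ fun M _ ↦ by fun_prop]
    calc _ ≤ ENNReal.ofReal (4 * (Up / Lo))
          + (∑ M ∈ F, ENNReal.ofReal (C * Real.exp (-(M.card * L M.card)))
            + ENNReal.ofReal (C * Real.exp (-(r * L r)))) := by
          gcongr with M hM
          exact hZFint M hM
      _ = ENNReal.ofReal (4 * (Up / Lo) + C * (∑ k ∈ Finset.Ico 1 r,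
            (p.choose k : ℝ) * Real.exp (-(k * L k)) + Real.exp (-(r * L r)))) := by
          rw [← ENNReal.ofReal_sum_of_nonneg fun M _ ↦ by positivity,
            ← ENNReal.ofReal_add (Finset.sum_nonneg fun M _ ↦ by positivity) (by positivity),
            ← ENNReal.ofReal_add (by positivity)
              (add_nonneg (Finset.sum_nonneg fun M _ ↦ by positivity) (by positivity)),
            ← Finset.mul_sum, ← mul_add, sum_filter_card fun k ↦ Real.exp (-(k * L k))]
      _ ≤ _ := ENNReal.ofReal_le_ofReal (by gcongr)
  · intro y M hM β hβ
    have hMr : M.card ≤ r := hM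
    have hsum : ∀ M ∈ F, ZF M y ≤ ∑ M ∈ F, ZF M y :=
      fun M hM ↦ Finset.single_le_sum (f := fun M ↦ ZF M y) (fun M _ ↦ hZF M y) hM
    have hsum0 : 0 ≤ ∑ M ∈ F, ZF M y := Finset.sum_nonneg fun M _ ↦ hZF M y
    have hθspan : θ ∈ Submodule.span ℝ {θ} := Submodule.mem_span_singleton_self θ
    have hq := hquad M β hβ
    unfold noise
    have hz0 := hZ0 y
    have hzr := hZr y
    rcases Nat.eq_zero_or_pos M.card with h0 | h0
    · have hM0 : M = ∅ := Finset.card_eq_zero.1 h0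
      have hβ0 : β = 0 := funext fun j ↦ hβ.1 j (by simp [hM0])
      have h1 := hZ0le y
      have h2 : X.mulVec β = 0 := by rw [hβ0, Matrix.mulVec_zero]
      rw [h2] at hq ⊢
      simp only [Pi.zero_apply] at hq ⊢
      rw [h0]
      linarith
    rcases hMr.lt_or_eq with hlt | heq
    · have hMF : M ∈ F := Finset.mem_filter.2 ⟨Finset.mem_univ M, Finset.mem_Ico.2 ⟨h0, hlt⟩⟩
      have h1 := hZFle M hMF y (X.mulVec β - θ) (Submodule.sub_mem _
        (Submodule.mem_sup_right (mulVec_mem_span_columns X hβ.1))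
        (Submodule.mem_sup_left hθspan))
      simp only [Pi.sub_apply] at h1
      have := hsum M hMF
      linarith
    · have h1 := hZrle (heq ▸ h0) y (X.mulVec β - θ) (Submodule.sub_mem _
        (Submodule.mem_sup_right ⟨β, rfl⟩) (Submodule.mem_sup_left hθspan))
      simp only [Pi.sub_apply] at h1
      rw [heq]
      linarith

lemma integrable_noise (h : IsNaturalExpFamily ν a b c) {n : ℕ} (θ ζ : Fin n → ℝ) :
    Integrable (noise a b θ ζ) (glmLaw ν a b c θ) := by
  have hp := h.isProbabilityMeasure
  refine (integrable_finsetSum _ fun i _ ↦ Integrable.const_mul ?_ _).const_mul _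
  exact integrable_comp_eval (μ := fun i ↦ expFamilyLaw ν a b c (θ i))
    (f := fun y ↦ y - deriv b (θ i)) ((h.integrable_id (θ i)).sub (integrable_const _))

lemma integral_noise (h : IsNaturalExpFamily ν a b c) {n : ℕ} (θ ζ : Fin n → ℝ) :
    ∫ y, noise a b θ ζ y ∂(glmLaw ν a b c θ) = 0 := by
  have hp := h.isProbabilityMeasure
  have hi : ∀ i, Integrable (fun y : ℝ ↦ y - deriv b (θ i)) (expFamilyLaw ν a b c (θ i)) :=
    fun i ↦ (h.integrable_id (θ i)).sub (integrable_const _)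
  have hterm : ∀ i, Integrable (fun y : Fin n → ℝ ↦ y i - deriv b (θ i)) (glmLaw ν a b c θ) :=
    fun i ↦ integrable_comp_eval (μ := fun i ↦ expFamilyLaw ν a b c (θ i))
      (f := fun y ↦ y - deriv b (θ i)) (hi i)
  unfold noise
  rw [integral_const_mul, integral_finsetSum _ fun i _ ↦ (hterm i).const_mul _]
  simp_rw [integral_const_mul]
  have hzero : ∀ i, ∫ y : Fin n → ℝ, (y i - deriv b (θ i)) ∂(glmLaw ν a b c θ) = 0 := by
    intro i
    have h1 := integral_comp_eval (μ := fun i ↦ expFamilyLaw ν a b c (θ i)) (i := i)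
      (f := fun y ↦ y - deriv b (θ i)) (hi i).aestronglyMeasurable
    refine h1.trans ?_
    rw [integral_sub (h.integrable_id _) (integrable_const _), h.integral_id]
    simp
  simp [hzero]

end NoiseExcess

theorem theorem1 {n p : ℕ}
    -- the exponential family and the curvature assumption
    (ν : Measure ℝ) [SigmaFinite ν] (a : ℝ) (b c : ℝ → ℝ)
    (hfam : IsNaturalExpFamily ν a b c)
    (Θ : Set ℝ) (Lo Up : ℝ) (hA : CurvatureAssumption b Θ Lo Up)
    -- the design matrix; any `rank X` of its columns are linearly independent
    (X : Matrix (Fin n) (Fin p) ℝ)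
    (hX : ∀ M : Finset (Fin p), M.card = X.rank →
      LinearIndependent ℝ (fun j : M => fun i : Fin n => X i j))
    -- the true natural parameters, not assumed to be of the form `X β`
    (θ : Fin n → ℝ) (hθ : ∀ i, θ i ∈ Θ)
    -- the independent observations
    {Ω : Type*} [MeasurableSpace Ω] (P : Measure Ω) [IsProbabilityMeasure P]
    (Y : Fin n → Ω → ℝ)
    (hlaw : ∀ i, HasLaw (Y i) (expFamilyLaw ν a b c (θ i)) P)
    (hindep : iIndepFun Y P)
    -- the weights and the penalty
    (L : ℕ → ℝ) (hL : ∀ k, 1 ≤ k → k ≤ X.rank → 0 < L k) (S : ℝ)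
    (hS : ∑ k ∈ Finset.Ico 1 X.rank, (p.choose k : ℝ) * Real.exp (-(k * L k))
      + Real.exp (-(X.rank * L X.rank)) ≤ S)
    (A : ℝ) (hA1 : 1 < A) (Pen : ℕ → ℝ) (hPen0 : 0 ≤ Pen 0)
    (hPen : ∀ k : ℕ, 1 ≤ k → k ≤ X.rank →
      2 * (Up / Lo) * k * (A + 2 * Real.sqrt (2 * L k) + 4 * L k) ≤ Pen k)
    -- the maximum likelihood estimators and the selected model
    (βhat : Ω → Finset (Fin p) → Fin p → ℝ)
    (hβ : ∀ ω, ∀ M ∈ models X, (coeffSet X Θ M).Nonempty →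
      IsMLE a b X Θ M (fun i => Y i ω) (βhat ω M))
    (Mhat : Ω → Finset (Fin p))
    (hM : ∀ ω, IsPenalizedSelection a b X Θ Pen (fun i => Y i ω) (βhat ω) (Mhat ω)) :
    ∫⁻ ω, glmKL ν a b c θ (X.mulVec (βhat ω (Mhat ω))) ∂P
      ≤ (4 / 3 : ℝ≥0∞) *
          (⨅ M ∈ models X, ((⨅ β ∈ coeffSet X Θ M, glmKL ν a b c θ (X.mulVec β))
            + ENNReal.ofReal (Pen M.card)))
        + ENNReal.ofReal (16 / 3 * (Up / Lo) * ((2 * A - 1) / (A - 1)) * S) := by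
  have hLo := hA.lo_pos
  have hUp := hA.up_pos
  have hprob := isProbabilityMeasure_glmLaw hfam θ
  have hS0 : 0 ≤ S := le_trans (by positivity) hS
  have hA2 : 0 < A - 1 := by linarith
  have hA3 : 0 < 2 * A - 1 := by linarith
  have hY : HasLaw (fun ω i ↦ Y i ω) (glmLaw ν a b c θ) P := by
    refine ⟨aemeasurable_pi_lambda _ fun i ↦ (hlaw i).aemeasurable, ?_⟩
    rw [hindep.map_fun_eq_pi_map fun i ↦ (hlaw i).aemeasurable]
    unfold glmLaw
    congr 1
    funext i
    exact (hlaw i).map_eq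
  obtain ⟨Z, hZm, hZ0, hZint, hZle⟩ :=
    exists_uniform_noise_excess hA hfam X hθ hL hS hA1 hPen0 hPen
  set D : ℝ := 4 * (Up / Lo) + 4 * (Up / Lo) * ((2 * A - 1) / (A - 1)) * S with hD
  have hZi : Integrable Z (glmLaw ν a b c θ) :=
    (lintegral_ofReal_ne_top_iff_integrable hZm.aestronglyMeasurable (ae_of_all _ hZ0)).1
      (hZint.trans_lt ENNReal.ofReal_lt_top).ne
  have hZD : ∫ y, Z y ∂(glmLaw ν a b c θ) ≤ D := by
    rw [integral_eq_lintegral_of_nonneg_ae (ae_of_all _ hZ0) hZm.aestronglyMeasurable]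
    exact ENNReal.toReal_le_of_le_ofReal (by positivity) hZint
  have hPenpos : ∀ M ∈ models X, 0 ≤ Pen M.card := by
    intro M hMm
    rcases Nat.eq_zero_or_pos M.card with h0 | h0
    · rwa [h0]
    · have hl := hL M.card h0 hMm
      exact le_trans (by positivity) (hPen M.card h0 hMm)
  have hoc : ∀ M ∈ models X, ∀ β ∈ coeffSet X Θ M,
      ∫⁻ ω, glmKL ν a b c θ (X.mulVec (βhat ω (Mhat ω))) ∂P
        ≤ (4 / 3 : ℝ≥0∞) * (glmKL ν a b c θ (X.mulVec β) + ENNReal.ofReal (Pen M.card))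
          + ENNReal.ofReal (16 / 3 * (Up / Lo) * ((2 * A - 1) / (A - 1)) * S) := by
    intro M hMm β hβM
    have hK0 : ∀ M' : Finset (Fin p), ∀ β' ∈ coeffSet X Θ M',
        0 ≤ bregmanKL a b θ (X.mulVec β') := by
      intro M' β' hβ'
      have ha := hfam.scale_pos
      exact le_trans (by positivity) (hA.sq_dist_le_bregmanKL hfam hθ hβ'.2)
    set R : ℝ := bregmanKL a b θ (X.mulVec β) + Pen M.card with hR
    set G : (Fin n → ℝ) → ℝ := fun y ↦
      4 / 3 * (R - noise a b θ (X.mulVec β) y - 4 * (Up / Lo) + Z y) with hG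
    have hi1 : Integrable (fun y ↦ R - noise a b θ (X.mulVec β) y) (glmLaw ν a b c θ) :=
      (integrable_const R).sub (integrable_noise hfam θ _)
    have hi2 : Integrable (fun y ↦ R - noise a b θ (X.mulVec β) y - 4 * (Up / Lo))
        (glmLaw ν a b c θ) := hi1.sub (integrable_const _)
    have hGi : Integrable G (glmLaw ν a b c θ) := (hi2.add hZi).const_mul _
    have hGval : ∫ y, G y ∂(glmLaw ν a b c θ)
        = 4 / 3 * (R - 4 * (Up / Lo) + ∫ y, Z y ∂(glmLaw ν a b c θ)) := by
      rw [hG, integral_const_mul, integral_add hi2 hZi, integral_sub hi1 (integrable_const _),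
        integral_sub (integrable_const R) (integrable_noise hfam θ _), integral_noise hfam]
      simp
    have hpt : ∀ ω, bregmanKL a b θ (X.mulVec (βhat ω (Mhat ω))) ≤ G fun i ↦ Y i ω := by
      intro ω
      obtain ⟨⟨hMh, hne⟩, hmin⟩ := hM ω
      have hmle := hβ ω M hMm ⟨β, hβM⟩
      have h1 := hmin M hMm ⟨β, hβM⟩
      have h2 : logLik a b (fun i ↦ Y i ω) (X.mulVec β)
          ≤ logLik a b (fun i ↦ Y i ω) (X.mulVec (βhat ω M)) := hmle.2 hβM
      have h3 := logLik_sub_logLik a b θ (X.mulVec β) fun i ↦ Y i ω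
      have h4 := logLik_sub_logLik a b θ (X.mulVec (βhat ω (Mhat ω))) fun i ↦ Y i ω
      have h5 := hZle (fun i ↦ Y i ω) (Mhat ω) hMh _ (hβ ω (Mhat ω) hMh hne).1
      simp only [hG, hR]
      linarith
    have hGi' : Integrable (fun ω ↦ G fun i ↦ Y i ω) P := by
      rw [← hY.map_eq] at hGi
      exact hGi.comp_aemeasurable hY.aemeasurable
    have hGval' : ∫ ω, G (fun i ↦ Y i ω) ∂P = ∫ y, G y ∂(glmLaw ν a b c θ) :=
      hY.integral_comp hGi.aestronglyMeasurable
    calc ∫⁻ ω, glmKL ν a b c θ (X.mulVec (βhat ω (Mhat ω))) ∂P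
        ≤ ∫⁻ ω, ENNReal.ofReal (G fun i ↦ Y i ω) ∂P := by
          refine lintegral_mono fun ω ↦ ?_
          rw [glmKL_eq_ofReal_bregmanKL hfam]
          exact ENNReal.ofReal_le_ofReal (hpt ω)
      _ = ENNReal.ofReal (∫ ω, G (fun i ↦ Y i ω) ∂P) := by
          refine (ofReal_integral_eq_lintegral_ofReal hGi' (ae_of_all _ fun ω ↦ ?_)).symm
          obtain ⟨⟨hMh, hne⟩, -⟩ := hM ω
          exact (hK0 _ _ (hβ ω (Mhat ω) hMh hne).1).trans (hpt ω)
      _ ≤ ENNReal.ofReal (4 / 3 * R + 16 / 3 * (Up / Lo) * ((2 * A - 1) / (A - 1)) * S) := by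
          refine ENNReal.ofReal_le_ofReal ?_
          rw [hGval', hGval]
          linarith
      _ = _ := by
          have h43 : ENNReal.ofReal (4 / 3) = (4 / 3 : ℝ≥0∞) := by
            rw [ENNReal.ofReal_div_of_pos (by norm_num)]
            simp
          rw [ENNReal.ofReal_add
              (mul_nonneg (by norm_num) (add_nonneg (hK0 M β hβM) (hPenpos M hMm)))
              (by positivity),
            ENNReal.ofReal_mul (by norm_num), h43,
            ENNReal.ofReal_add (hK0 M β hβM) (hPenpos M hMm), glmKL_eq_ofReal_bregmanKL hfam]
  -- Subtract and divide to pass to the infimum: `4 / 3` is neither `0` nor `∞`.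
  have h0 : (4 / 3 : ℝ≥0∞) ≠ 0 := by simp
  have htop : (4 / 3 : ℝ≥0∞) ≠ ∞ := ENNReal.div_ne_top (by simp) (by simp)
  rw [← tsub_le_iff_right, mul_comm (4 / 3 : ℝ≥0∞), ← ENNReal.div_le_iff h0 htop]
  refine le_iInf₂ fun M hMm ↦ ?_
  rw [← tsub_le_iff_right]
  refine le_iInf₂ fun β hβM ↦ ?_
  rw [tsub_le_iff_right, ENNReal.div_le_iff h0 htop, tsub_le_iff_right, mul_comm _ (4 / 3 : ℝ≥0∞)]
  exact hoc M hMm β hβM
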